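/- Let $1<p<\infty$, let $p'$ be the conjugate exponent ($\frac1p+\frac1{p'}=1$), and let $\Omega=(\Omega_n)_{n\ge0}$ be a sequence of nonnegative real numbers with $\Omega_0\neq0$ and $\sum_n\Omega_n=\infty$; no monotonicity is assumed. For a complex sequence $f=(f(n))_{n\ge0}$ let $f^*(n)=\inf\{s>0:\#\{k:|f(k)|>s\}\le n\}\in[0,\infty]$ ($n\ge0$) be its nonincreasing rearrangement. For a weight sequence $w=(w_n)_{n\ge0}$ in $[0,\infty]$ and $0<q<\infty$ put $$\|f\|_{d(w,q)}=\Big(\sum_{n=0}^\infty f^*(n)^q\,w_n\Big)^{1/q},\qquad d(w,q)=\{f:\|f\|_{d(w,q)}<\infty\},$$ with the convention $0\cdot\infty=0$, and let the associate space of $d(\Omega,p)$ be $$d(\Omega,p)'=\{f:\|f\|_{d(\Omega,p)'}<\infty\},\qquad \|f\|_{d(\Omega,p)'}=\sup\Big\{\sum_{n=0}^\infty|f(n)g(n)|:\|g\|_{d(\Omega,p)}\le1\Big\}.$$ Let $\Omega^{1-p'}=(\Omega_n^{1-p'})_{n\ge 0}$, where $0^{1-p'}=\infty$, and let $A_d\Omega(n)=\frac1{n+1}\sum_{k=0}^n\Omega_k$.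 Then $d(\Omega,p)'=d(\Omega^{1-p'},p')$ (as sets of sequences) if and only if there is a constant $C<\infty$ such that $$\sum_{k=0}^n\Omega_k^{1-p'}\le C\sum_{k=0}^n\big(A_d\Omega(k)\big)^{1-p'}\qquad\text{for all }n=0,1,2,\dots$$ Moreover, whenever the two spaces are equal, the functionals $\|\cdot\|_{d(\Omega,p)'}$ and $\|\cdot\|_{d(\Omega^{1-p'},p')}$ are equivalent, that is, each is bounded by a constant multiple of the other. In particular, the two spaces are equal whenever $\Omega$ is regular, i.e. whenever there is a constant $C<\infty$ with $A_d\Omega(n)\le C\,\Omega_n$ for all $n\ge0$. -/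

import Mathlib

open scoped NNReal ENNReal

noncomputable section

namespace LorentzSeq

/-- The distribution function `λ_f(s)` of a sequence: the number of indices `k` with `|f k| > s`
(counting measure on `{0, 1, 2, …}`). -/
def distribution (f : ℕ → ℂ) (s : ℝ≥0∞) : ℕ∞ :=
  {k : ℕ | s < ‖f k‖ₑ}.encard

/-- The nonincreasing rearrangement `f^*(n) = inf {s > 0 : λ_f(s) ≤ n}`, with values in `[0, ∞]`
(it is infinite exactly when `f` is unbounded). -/
def rearrangement (f : ℕ → ℂ) (n : ℕ) : ℝ≥0∞ :=
  sInf {s : ℝ≥0∞ | 0 < s ∧ distribution f s ≤ n}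

/-- The functional `‖f‖_{d(w, p)} = (∑ₙ (f^*(n))^p wₙ)^{1/p}` for a weight sequence `w` with values
in `[0, ∞]`; here `0 · ∞ = 0`. -/
def lorentzNorm (w : ℕ → ℝ≥0∞) (p : ℝ) (f : ℕ → ℂ) : ℝ≥0∞ :=
  (∑' n, rearrangement f n ^ p * w n) ^ (1 / p)

/-- The sequence Lorentz space `d(w, p)`. -/
def lorentzSpace (w : ℕ → ℝ≥0∞) (p : ℝ) : Set (ℕ → ℂ) :=
  {f | lorentzNorm w p f < ∞}

/-- The associate norm of a functional `N` on sequences: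
`sup {∑ₙ |f(n) g(n)| : N(g) ≤ 1}`. -/
def associateNorm (N : (ℕ → ℂ) → ℝ≥0∞) (f : ℕ → ℂ) : ℝ≥0∞ :=
  ⨆ (g : ℕ → ℂ) (_ : N g ≤ 1), ∑' n, ‖f n * g n‖ₑ

/-- The associate space of `{f | N f < ∞}`. -/
def associateSpace (N : (ℕ → ℂ) → ℝ≥0∞) : Set (ℕ → ℂ) :=
  {f | associateNorm N f < ∞}

/-- The discrete Hardy operator `A_d f(n) = (1 / (n + 1)) ∑_{k = 0}^n f(k)`. -/
def hardy (f : ℕ → ℝ≥0) (n : ℕ) : ℝ≥0 :=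
  (∑ k ∈ Finset.range (n + 1), f k) / (n + 1)

/-- A sequence of nonnegative numbers is regular if `A_d Ω(n) ≤ C Ω(n)` for all `n`. -/
def IsRegular (Ω : ℕ → ℝ≥0) : Prop :=
  ∃ C : ℝ≥0, ∀ n, hardy Ω n ≤ C * Ω n

/-- The `[0, ∞]`-valued sequence `Ω^r`; for `r < 0` it is `∞` where `Ω` vanishes. -/
def weightPow (Ω : ℕ → ℝ≥0) (r : ℝ) (n : ℕ) : ℝ≥0∞ :=
  (Ω n : ℝ≥0∞) ^ r

end LorentzSeq

end

/-!
Write `q` for the conjugate exponent `p'`, `f^*` for the rearrangement, `F` and `W` for the partial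
sums of `f^*` and `Ω`, and `A` for the associate norm of `f`.

The Hardy–Littlewood inequality and Hölder's inequality show that `A` never exceeds the norm of `f`
in `d(Ω^{1-q}, q)` (`associateNorm_le_lorentzNorm`). The theorem is therefore about the opposite
inequality. The bridge is the sum `∑ (f^*)^q (A_d Ω)^{1-q}`.

This sum is bounded by a multiple of `A^q` for every weight
(`sum_rearrangement_rpow_mul_hardy_le`). The associate norm may be tested on any nonincreasing
sequence `h`, and the choice is `h = φ^{q-1}` with `φ_n = max_{n ≤ k ≤ N} F_k / W_k`. Where `φ`
drops it equals `F / W`, so Abel summation and Young's inequality give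
`∑ φ^q Ω ≤ p ∑ f^* φ^{q-1}` (`sum_level_rpow_le`), and `φ_n ≥ f^*(n) / A_d Ω(n)`. If the partial sums
of `Ω^{1-q}` are controlled by those of `(A_d Ω)^{1-q}`, then Abel summation against the nonincreasing
`(f^*)^q` bounds the norm of `d(Ω^{1-q}, q)` by `A` (`lorentzNorm_le_associateNorm`).

Conversely, for the indicator of `{0, …, n}` the bridge is sharp: `A^q` is at most a multiple of
`∑_{k ≤ n} (A_d Ω(k))^{1-q}` (`sum_range_enorm_le`). This is Hölder's inequality with weights
`h_i^{1/q}`, where `h` is a nonincreasing majorant of `(A_d Ω)^{1-q}` with comparable sum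
(`exists_majorant`). If the condition on the partial sums fails, a suitable series of such indicators
lies in the associate space and has infinite norm in `d(Ω^{1-q}, q)` (`exists_bound_of_subset`).
So equality of the spaces forces the condition, and the condition gives equivalent norms.
-/

namespace LorentzSeq

/-! ### The nonincreasing rearrangement -/

theorem distribution_antitone (f : ℕ → ℂ) : Antitone (distribution f) :=
  fun _ _ hst => Set.encard_le_encard fun _ hk => hst.trans_lt hk

/-- The case `s = 0` is included although the infimum defining the rearrangement only runs over
positive levels. -/
theorem rearrangement_le_of_distribution_le {f : ℕ → ℂ} {n : ℕ} {s : ℝ≥0∞}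
    (h : distribution f s ≤ n) : rearrangement f n ≤ s := by
  refine le_of_forall_gt_imp_ge_of_dense fun t ht => ?_
  exact sInf_le ⟨(zero_le (a := s)).trans_lt ht, (distribution_antitone f ht.le).trans h⟩

theorem lt_distribution_of_lt_rearrangement {f : ℕ → ℂ} {n : ℕ} {s : ℝ≥0∞} (hs : 0 < s)
    (h : s < rearrangement f n) : (n : ℕ∞) < distribution f s := by
  by_contra! hle
  exact absurd (sInf_le (show s ∈ {s : ℝ≥0∞ | 0 < s ∧ distribution f s ≤ n} from ⟨hs, hle⟩))
    (not_le.2 h)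

theorem rearrangement_antitone (f : ℕ → ℂ) : Antitone (rearrangement f) := by
  intro m n hmn
  refine sInf_le_sInf fun s hs => ⟨hs.1, hs.2.trans ?_⟩
  exact_mod_cast hmn

theorem le_rearrangement_of_finset {f : ℕ → ℂ} {c : ℝ≥0∞} {s : Finset ℕ}
    (hc : ∀ k ∈ s, c ≤ ‖f k‖ₑ) {n : ℕ} (hn : n < s.card) : c ≤ rearrangement f n := by
  refine le_sInf fun t ht => ?_
  by_contra! htc
  have h1 : ((s.card : ℕ) : ℕ∞) ≤ n := by
    rw [← Set.encard_coe_eq_coe_finsetCard]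
    exact (Set.encard_le_encard fun k hk => htc.trans_le (hc k hk)).trans ht.2
  exact absurd hn (not_lt.2 (by exact_mod_cast h1))

theorem sum_enorm_le_sum_rearrangement (g : ℕ → ℂ) (s : Finset ℕ) :
    ∑ k ∈ s, ‖g k‖ₑ ≤ ∑ i ∈ Finset.range s.card, rearrangement g i := by
  induction s using Finset.induction_on_min_value (fun k => ‖g k‖ₑ) with
  | empty => simp
  | insert a s ha hmin ih =>
    rw [Finset.sum_insert ha, Finset.card_insert_of_notMem ha, Finset.sum_range_succ, add_comm]
    refine add_le_add ih (le_rearrangement_of_finset (s := insert a s) ?_ ?_)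
    · intro k hk
      rcases Finset.mem_insert.1 hk with rfl | hk
      · exact le_rfl
      · exact hmin k hk
    · simp [Finset.card_insert_of_notMem ha]

/-- The Hardy–Littlewood inequality above a level `c`. The levels make the induction on the finite
set work: removing the point where `‖f‖` is smallest raises the level to that smallest value. -/
theorem sum_tsub_mul_le_sum_rearrangement (f g : ℕ → ℂ) (s : Finset ℕ) :
    ∀ c : ℝ≥0∞, (∀ k ∈ s, c ≤ ‖f k‖ₑ) → ∑ k ∈ s, (‖f k‖ₑ - c) * ‖g k‖ₑ ≤
      ∑ i ∈ Finset.range s.card, (rearrangement f i - c) * rearrangement g i := by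
  induction s using Finset.induction_on_min_value (fun k => ‖f k‖ₑ) with
  | empty => simp
  | insert a s ha hmin ih =>
    intro c hc
    have hca := hc a (Finset.mem_insert_self a s)
    have hmin' : ∀ k ∈ insert a s, ‖f a‖ₑ ≤ ‖f k‖ₑ := by
      intro k hk
      rcases Finset.mem_insert.1 hk with rfl | hk
      · exact le_rfl
      · exact hmin k hk
    calc ∑ k ∈ insert a s, (‖f k‖ₑ - c) * ‖g k‖ₑ
        = ∑ k ∈ insert a s, ((‖f k‖ₑ - ‖f a‖ₑ) * ‖g k‖ₑ + (‖f a‖ₑ - c) * ‖g k‖ₑ) := by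
          refine Finset.sum_congr rfl fun k hk => ?_
          rw [← add_mul, tsub_add_tsub_cancel (hmin' k hk) hca]
      _ = ∑ k ∈ s, (‖f k‖ₑ - ‖f a‖ₑ) * ‖g k‖ₑ + (‖f a‖ₑ - c) * ∑ k ∈ insert a s, ‖g k‖ₑ := by
          rw [Finset.sum_add_distrib, Finset.mul_sum, Finset.sum_insert ha]
          simp
      _ ≤ ∑ i ∈ Finset.range s.card, (rearrangement f i - ‖f a‖ₑ) * rearrangement g i +
            (‖f a‖ₑ - c) * ∑ i ∈ Finset.range (insert a s).card, rearrangement g i := by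
          gcongr
          · exact ih _ hmin
          · exact sum_enorm_le_sum_rearrangement g _
      _ ≤ ∑ i ∈ Finset.range (insert a s).card, (rearrangement f i - ‖f a‖ₑ) * rearrangement g i +
            (‖f a‖ₑ - c) * ∑ i ∈ Finset.range (insert a s).card, rearrangement g i := by
          gcongr
          exact Finset.subset_insert a s
      _ = ∑ i ∈ Finset.range (insert a s).card, (rearrangement f i - c) * rearrangement g i := by
          rw [Finset.mul_sum, ← Finset.sum_add_distrib]
          refine Finset.sum_congr rfl fun i hi => ?_
          rw [← add_mul, tsub_add_tsub_cancel
            (le_rearrangement_of_finset hmin' (Finset.mem_range.1 hi)) hca]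

/-- The Hardy–Littlewood rearrangement inequality. -/
theorem tsum_enorm_mul_le (f g : ℕ → ℂ) :
    ∑' n, ‖f n * g n‖ₑ ≤ ∑' n, rearrangement f n * rearrangement g n := by
  rw [ENNReal.tsum_eq_iSup_sum]
  refine iSup_le fun s => ?_
  have h := sum_tsub_mul_le_sum_rearrangement f g s 0 fun _ _ => zero_le
  simp only [tsub_zero] at h
  simp only [enorm_mul]
  exact h.trans (ENNReal.sum_le_tsum _)

theorem le_rearrangement_of_antitone {f : ℕ → ℝ≥0} (hf : Antitone f) (n : ℕ) :
    (f n : ℝ≥0∞) ≤ rearrangement (fun k => ((f k : ℝ) : ℂ)) n := by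
  refine le_rearrangement_of_finset (s := Finset.range (n + 1)) (fun k hk => ?_) (by simp)
  have h1 : ‖((f k : ℝ) : ℂ)‖ₑ = (f k : ℝ≥0∞) := by
    rw [enorm_eq_nnnorm]; congr 1; ext; simp
  rw [h1]
  exact_mod_cast hf (Nat.lt_succ_iff.1 (Finset.mem_range.1 hk))

/-! ### Abel summation and Hölder's inequality -/

/-- Against an antitone sequence, domination of partial sums suffices. All quantities may be
infinite. -/
theorem sum_mul_le_sum_mul_of_antitone {b c : ℕ → ℝ≥0∞} {N : ℕ}
    (hbc : ∀ m ≤ N, ∑ i ∈ Finset.range m, b i ≤ ∑ i ∈ Finset.range m, c i) :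
    ∀ {a : ℕ → ℝ≥0∞}, Antitone a →
      ∑ i ∈ Finset.range N, a i * b i ≤ ∑ i ∈ Finset.range N, a i * c i := by
  induction N with
  | zero => simp
  | succ N ih =>
    intro a ha
    have key : ∀ d : ℕ → ℝ≥0∞, ∑ i ∈ Finset.range (N + 1), a i * d i =
        ∑ i ∈ Finset.range N, (a i - a N) * d i + a N * ∑ i ∈ Finset.range (N + 1), d i := by
      intro d
      have h0 : ∑ i ∈ Finset.range N, (a i - a N) * d i =
          ∑ i ∈ Finset.range (N + 1), (a i - a N) * d i := by
        simp [Finset.sum_range_succ]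
      rw [h0, Finset.mul_sum, ← Finset.sum_add_distrib]
      refine Finset.sum_congr rfl fun i hi => ?_
      rw [← add_mul, tsub_add_cancel_of_le (ha (Nat.lt_succ_iff.1 (Finset.mem_range.1 hi)))]
    rw [key, key]
    refine add_le_add (ih (fun m hm => hbc m (hm.trans N.le_succ))
      fun i j hij => tsub_le_tsub_right (ha hij) _)
      (mul_le_mul' le_rfl (hbc _ le_rfl))

/-- Hölder's inequality between `d(Ω, p)` and `d(Ω^{1-q}, q)`, which holds for every weight. -/
theorem associateNorm_le_lorentzNorm {p q : ℝ} (hpq : p.HolderConjugate q) (Ω : ℕ → ℝ≥0)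
    (f : ℕ → ℂ) : associateNorm (lorentzNorm (fun k => (Ω k : ℝ≥0∞)) p) f ≤
      lorentzNorm (weightPow Ω (1 - q)) q f := by
  have hp := hpq.pos
  have hq := hpq.symm.pos
  rcases eq_or_ne (lorentzNorm (weightPow Ω (1 - q)) q f) ∞ with htop | htop
  · rw [htop]; exact le_top
  refine iSup₂_le fun g hg => (tsum_enorm_mul_le f g).trans ?_
  rw [ENNReal.tsum_eq_iSup_sum]
  refine iSup_le fun s => ?_
  have hsum : ∑' n, rearrangement f n ^ q * weightPow Ω (1 - q) n ≠ ∞ := by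
    intro h
    exact htop (by rw [lorentzNorm, h, ENNReal.top_rpow_of_pos (by positivity)])
  have hqp : q / p = q - 1 := by
    have := hpq.symm.sub_one_mul_conj
    field_simp
    linarith
  calc ∑ n ∈ s, rearrangement f n * rearrangement g n
      ≤ ∑ n ∈ s, (rearrangement f n * (Ω n : ℝ≥0∞) ^ (-(1 / p))) *
          (rearrangement g n * (Ω n : ℝ≥0∞) ^ (1 / p)) := by
        refine Finset.sum_le_sum fun n _ => ?_
        rcases eq_or_ne (Ω n) 0 with h0 | h0
        -- where the weight of `f` is infinite, finiteness of its norm forces `f^*(n) = 0`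
        · have h1 := ENNReal.ne_top_of_tsum_ne_top hsum n
          have h2 : rearrangement f n = 0 := by
            by_contra h2
            refine h1 ?_
            rw [weightPow, h0, ENNReal.coe_zero, ENNReal.zero_rpow_of_neg
              (by linarith [hpq.symm.lt]), ENNReal.mul_top]
            simp [ENNReal.rpow_eq_zero_iff, h2, hq.not_gt]
          simp [h2]
        · have h1 : (Ω n : ℝ≥0∞) ^ (-(1 / p)) * (Ω n : ℝ≥0∞) ^ (1 / p) = 1 := by
            rw [← ENNReal.rpow_add _ _ (by simpa using h0) ENNReal.coe_ne_top]
            simp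
          rw [mul_mul_mul_comm, h1, mul_one]
    _ ≤ (∑ n ∈ s, (rearrangement f n * (Ω n : ℝ≥0∞) ^ (-(1 / p))) ^ q) ^ (1 / q) *
          (∑ n ∈ s, (rearrangement g n * (Ω n : ℝ≥0∞) ^ (1 / p)) ^ p) ^ (1 / p) :=
        ENNReal.inner_le_Lp_mul_Lq s _ _ hpq.symm
    _ ≤ lorentzNorm (weightPow Ω (1 - q)) q f * lorentzNorm (fun k => (Ω k : ℝ≥0∞)) p g := by
        unfold lorentzNorm
        gcongr
        · refine le_trans (le_of_eq (Finset.sum_congr rfl fun n _ => ?_))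
            (ENNReal.sum_le_tsum s)
          rw [ENNReal.mul_rpow_of_nonneg _ _ hq.le, ← ENNReal.rpow_mul, weightPow]
          congr 2
          rw [← neg_sub, ← hqp]
          ring
        · refine le_trans (le_of_eq (Finset.sum_congr rfl fun n _ => ?_))
            (ENNReal.sum_le_tsum s)
          rw [ENNReal.mul_rpow_of_nonneg _ _ hp.le, ← ENNReal.rpow_mul,
            one_div_mul_cancel hp.ne', ENNReal.rpow_one]
    _ ≤ lorentzNorm (weightPow Ω (1 - q)) q f := mul_le_of_le_one_right' hg

open Filter Topology

/-! ### Lower bounds for the associate norm -/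

theorem exists_injOn_le_enorm {f : ℕ → ℂ} {t : ℕ → ℝ≥0∞}
    (ht : ∀ i, t i = 0 ∨ t i < rearrangement f i) (N : ℕ) :
    ∃ k : ℕ → ℕ, Set.InjOn k (Finset.range N) ∧ ∀ i ∈ Finset.range N, t i ≤ ‖f (k i)‖ₑ := by
  induction N with
  | zero => exact ⟨id, by simp⟩
  | succ N ih =>
    obtain ⟨k, hk, hkt⟩ := ih
    obtain ⟨x, hx, hxk⟩ : ∃ x, t N ≤ ‖f x‖ₑ ∧ x ∉ (Finset.range N).image k := by
      by_contra! hcon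
      have hle : {x | t N ≤ ‖f x‖ₑ}.encard ≤ N := by
        refine (Set.encard_le_encard (fun x hx => hcon x hx)).trans ?_
        rw [Set.encard_coe_eq_coe_finsetCard]
        exact_mod_cast Finset.card_image_le.trans_eq (Finset.card_range N)
      rcases eq_or_ne (t N) 0 with h0 | h0
      · simp only [h0, zero_le, Set.ofPred_true, Set.encard_univ] at hle
        exact absurd hle (by simp)
      · refine absurd (lt_distribution_of_lt_rearrangement (pos_iff_ne_zero.2 h0)
          ((ht N).resolve_left h0)) (not_lt.2 (le_trans ?_ hle))
        exact Set.encard_le_encard fun x (hx : t N < ‖f x‖ₑ) => (hx.le : t N ≤ ‖f x‖ₑ)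
    refine ⟨Function.update k N x, ?_, ?_⟩
    · intro i hi j hj hij
      simp only [Finset.coe_range, Set.mem_Iio] at hi hj
      simp only [Finset.mem_image, Finset.mem_range, not_exists, not_and] at hxk
      rcases Nat.lt_succ_iff_lt_or_eq.1 hi with hi' | rfl <;>
        rcases Nat.lt_succ_iff_lt_or_eq.1 hj with hj' | rfl
      · rw [Function.update_of_ne hi'.ne, Function.update_of_ne hj'.ne] at hij
        exact hk (by simpa using hi') (by simpa using hj') hij
      · rw [Function.update_of_ne hi'.ne, Function.update_self] at hij
        exact absurd hij (hxk i hi')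
      · rw [Function.update_of_ne hj'.ne, Function.update_self] at hij
        exact absurd hij.symm (hxk j hj')
      · rfl
    · intro i hi
      rcases Nat.lt_succ_iff_lt_or_eq.1 (Finset.mem_range.1 hi) with hi' | rfl
      · rw [Function.update_of_ne hi'.ne]
        exact hkt i (Finset.mem_range.2 hi')
      · rwa [Function.update_self]

/-- The values of a nonincreasing finite sequence `h` may be placed at any indices `k i` without
increasing the Lorentz functional. -/
theorem exists_lorentzNorm_le {p : ℝ} (hp : 0 < p) (Ω : ℕ → ℝ≥0) {h : ℕ → ℝ≥0} (hh : Antitone h)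
    {N : ℕ} {k : ℕ → ℕ} (hk : Set.InjOn k (Finset.range N)) :
    ∃ g : ℕ → ℂ, (∀ i ∈ Finset.range N, ‖g (k i)‖ₑ = h i) ∧
      lorentzNorm (fun k => (Ω k : ℝ≥0∞)) p g ≤
        (∑ i ∈ Finset.range N, (h i : ℝ≥0∞) ^ p * Ω i) ^ (1 / p) := by
  set v : ℕ → ℝ≥0 := fun x => ∑ i ∈ Finset.range N, if k i = x then h i else 0 with hv
  have hnorm : ∀ x, ‖((v x : ℝ) : ℂ)‖ₑ = (v x : ℝ≥0∞) := by
    intro x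
    rw [enorm_eq_nnnorm]; congr 1; ext; simp
  have hvk : ∀ i ∈ Finset.range N, v (k i) = h i := by
    intro i hi
    rw [hv]
    dsimp only
    rw [Finset.sum_eq_single i]
    · simp
    · intro j hj hji
      rw [if_neg fun hkk => hji (hk (by simpa using hj) (by simpa using hi) hkk)]
    · exact fun hi' => absurd hi hi'
  have hv0 : ∀ x, v x ≠ 0 → ∃ i ∈ Finset.range N, k i = x := by
    intro x hx
    by_contra! hcon
    exact hx (Finset.sum_eq_zero fun i hi => if_neg (hcon i hi))
  refine ⟨fun x => ((v x : ℝ) : ℂ), fun i hi => by rw [hnorm, hvk i hi], ?_⟩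
  have hdist : ∀ (n : ℕ) (s : ℝ≥0∞), (∀ i ∈ Finset.range N, n ≤ i → (h i : ℝ≥0∞) ≤ s) →
      rearrangement (fun x => ((v x : ℝ) : ℂ)) n ≤ s := by
    intro n s hs
    refine rearrangement_le_of_distribution_le ?_
    have hsub : {x : ℕ | s < ‖((v x : ℝ) : ℂ)‖ₑ} ⊆ (Finset.range n).image k := by
      intro x hx
      simp only [Set.mem_ofPred_eq, hnorm] at hx
      obtain ⟨i, hi, rfl⟩ := hv0 x (by rintro h0; simp [h0] at hx)
      rw [hvk i hi] at hx
      refine Finset.mem_coe.2 (Finset.mem_image_of_mem k (Finset.mem_range.2 ?_))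
      by_contra! hni
      exact absurd (hs i hi hni) (not_le.2 hx)
    refine (Set.encard_le_encard hsub).trans ?_
    rw [Set.encard_coe_eq_coe_finsetCard]
    exact_mod_cast Finset.card_image_le.trans_eq (Finset.card_range n)
  unfold lorentzNorm
  gcongr
  rw [tsum_eq_sum (s := Finset.range N)]
  · gcongr with i hi
    exact hdist i _ fun j _ hij => by exact_mod_cast hh hij
  · intro n hn
    have h0 : rearrangement (fun x => ((v x : ℝ) : ℂ)) n = 0 := by
      refine le_antisymm (hdist n 0 fun i hi hni => ?_) (zero_le)
      exact absurd ((Finset.mem_range.1 hi).trans_le' hni) (by simpa using hn)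
    rw [h0, ENNReal.zero_rpow_of_pos hp, zero_mul]

/-- Together with the Hardy–Littlewood inequality this says that the associate norm is computed on
nonincreasing sequences. -/
theorem sum_rearrangement_mul_le_associateNorm {p : ℝ} (hp : 0 < p) (Ω : ℕ → ℝ≥0) (f : ℕ → ℂ)
    {h : ℕ → ℝ≥0} (hh : Antitone h) {N : ℕ}
    (hN : ∑ i ∈ Finset.range N, (h i : ℝ≥0∞) ^ p * Ω i ≤ 1) :
    ∑ i ∈ Finset.range N, rearrangement f i * h i ≤
      associateNorm (lorentzNorm (fun k => (Ω k : ℝ≥0∞)) p) f := by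
  have hseq : ∀ i, ∃ u : ℕ → ℝ≥0∞, (∀ n, u n = 0 ∨ u n < rearrangement f i) ∧
      Tendsto u atTop (𝓝 (rearrangement f i)) := by
    intro i
    rcases eq_or_ne (rearrangement f i) 0 with h0 | h0
    · exact ⟨fun _ => 0, fun _ => Or.inl rfl, by rw [h0]; exact tendsto_const_nhds⟩
    · obtain ⟨u, -, hu, hlim⟩ := exists_seq_strictMono_tendsto' (pos_iff_ne_zero.2 h0)
      exact ⟨u, fun n => Or.inr (hu n).2, hlim⟩
  choose u hu hlim using hseq
  have htend : Tendsto (fun n => ∑ i ∈ Finset.range N, u i n * h i) atTop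
      (𝓝 (∑ i ∈ Finset.range N, rearrangement f i * h i)) :=
    tendsto_finsetSum _ fun i _ =>
      ENNReal.Tendsto.mul_const (hlim i) (Or.inr ENNReal.coe_ne_top)
  refine le_of_tendsto' htend fun n => ?_
  obtain ⟨k, hk, hkt⟩ := exists_injOn_le_enorm (t := fun i => u i n) (fun i => hu i n) N
  obtain ⟨g, hg, hgN⟩ := exists_lorentzNorm_le hp Ω hh hk
  have hg1 : lorentzNorm (fun k => (Ω k : ℝ≥0∞)) p g ≤ 1 :=
    hgN.trans (ENNReal.rpow_le_one hN (by positivity))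
  calc ∑ i ∈ Finset.range N, u i n * h i
      ≤ ∑ i ∈ Finset.range N, ‖f (k i) * g (k i)‖ₑ := by
        refine Finset.sum_le_sum fun i hi => ?_
        rw [enorm_mul, hg i hi]
        gcongr
        exact hkt i hi
    _ = ∑ x ∈ (Finset.range N).image k, ‖f x * g x‖ₑ := by
        rw [Finset.sum_image hk]
    _ ≤ ∑' x, ‖f x * g x‖ₑ := ENNReal.sum_le_tsum _
    _ ≤ _ := le_iSup₂ (f := fun (g : ℕ → ℂ) (_ : lorentzNorm (fun k => (Ω k : ℝ≥0∞)) p g ≤ 1) =>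
        ∑' n, ‖f n * g n‖ₑ) g hg1

theorem rearrangement_ne_top_of_associateNorm_ne_top {p : ℝ} (hp : 0 < p) {Ω : ℕ → ℝ≥0}
    (hΩ0 : Ω 0 ≠ 0) {f : ℕ → ℂ}
    (hf : associateNorm (lorentzNorm (fun k => (Ω k : ℝ≥0∞)) p) f ≠ ∞) (n : ℕ) :
    rearrangement f n ≠ ∞ := by
  intro htop
  have h0 : rearrangement f 0 = ∞ := top_le_iff.1 (htop ▸ rearrangement_antitone f n.zero_le)
  have hc : Ω 0 ^ (-(1 / p)) ≠ 0 := by simp [NNReal.rpow_eq_zero_iff, hΩ0]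
  have := sum_rearrangement_mul_le_associateNorm hp Ω f (h := fun _ => Ω 0 ^ (-(1 / p)))
    (fun _ _ _ => le_rfl) (N := 1) ?_
  · rw [Finset.sum_range_one, h0, ENNReal.top_mul (by exact_mod_cast hc)] at this
    exact hf (top_le_iff.1 this)
  · rw [Finset.sum_range_one, ← ENNReal.coe_rpow_of_nonneg _ hp.le, ← NNReal.rpow_mul,
      neg_mul, one_div_mul_cancel hp.ne', NNReal.rpow_neg_one, ← ENNReal.coe_mul,
      inv_mul_cancel₀ hΩ0, ENNReal.coe_one]

/-! ### The level function -/

theorem sum_mul_eq_sum_partial_mul_sub (y ω : ℕ → ℝ) (N : ℕ) :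
    ∑ i ∈ Finset.range N, y i * ω i =
      ∑ i ∈ Finset.range N, (∑ j ∈ Finset.range (i + 1), ω j) * (y i - y (i + 1)) +
        (∑ j ∈ Finset.range N, ω j) * y N := by
  induction N with
  | zero => simp
  | succ N ih =>
    rw [Finset.sum_range_succ, ih, Finset.sum_range_succ _ N, Finset.sum_range_succ ω N]
    ring

theorem mul_rpow_sub_one_le {p q : ℝ} (hpq : p.HolderConjugate q) {c d : ℝ} (hc : 0 ≤ c)
    (hd : 0 ≤ d) : c * d ^ (q - 1) ≤ c ^ q / q + d ^ q / p := by
  have hy := Real.young_inequality_of_nonneg hc (Real.rpow_nonneg hd (q - 1)) hpq.symm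
  rwa [← Real.rpow_mul hd, hpq.symm.sub_one_mul_conj] at hy

theorem mul_rpow_sub_one {q : ℝ} (hq : q ≠ 0) {c : ℝ} (hc : 0 ≤ c) : c * c ^ (q - 1) = c ^ q := by
  rw [← Real.rpow_one_add' hc (by simpa using hq), add_sub_cancel]

theorem rpow_sub_rpow_le {p q : ℝ} (hpq : p.HolderConjugate q) {c d : ℝ} (hc : 0 ≤ c)
    (hd : 0 ≤ d) : c ^ q - d ^ q ≤ p * (c * (c ^ (q - 1) - d ^ (q - 1))) := by
  have hp := hpq.pos
  have hq := hpq.symm.pos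
  have hy := mul_rpow_sub_one_le hpq hc hd
  have hcq := mul_rpow_sub_one hq.ne' hc
  have hpq' : p / q = p - 1 := by
    have := hpq.sub_one_mul_conj
    field_simp
    linarith
  have h2 : p * (c * d ^ (q - 1)) ≤ (p - 1) * c ^ q + d ^ q := by
    calc p * (c * d ^ (q - 1)) ≤ p * (c ^ q / q + d ^ q / p) := by gcongr
      _ = p / q * c ^ q + d ^ q := by field_simp
      _ = _ := by rw [hpq']
  rw [mul_sub, mul_sub, hcq]
  linarith

/-- The maximum of the quotients `(∑_{j ≤ k} a j) / (∑_{j ≤ k} Ω j)` over `n ≤ k ≤ N`, and `0` for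
`n > N`. It is a substitute for the level function of `a` with respect to `Ω`, which would be the
slope of a least concave majorant. -/
noncomputable def level (a Ω : ℕ → ℝ≥0) (N n : ℕ) : ℝ≥0 :=
  (Finset.Icc n N).sup fun k =>
    (∑ j ∈ Finset.range (k + 1), a j) / ∑ j ∈ Finset.range (k + 1), Ω j

theorem level_antitone (a Ω : ℕ → ℝ≥0) (N : ℕ) : Antitone (level a Ω N) :=
  fun _ _ hmn => Finset.sup_mono (Finset.Icc_subset_Icc_left hmn)

theorem sum_range_pos {Ω : ℕ → ℝ≥0} (hΩ0 : Ω 0 ≠ 0) (n : ℕ) :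
    0 < ∑ j ∈ Finset.range (n + 1), Ω j :=
  (pos_iff_ne_zero.2 hΩ0).trans_le
    (Finset.single_le_sum (f := Ω) (fun _ _ => zero_le) (by simp))

theorem hardy_pos {Ω : ℕ → ℝ≥0} (hΩ0 : Ω 0 ≠ 0) (n : ℕ) : 0 < hardy Ω n :=
  div_pos (sum_range_pos hΩ0 n) (by positivity)

theorem sum_level_rpow_le {p q : ℝ} (hpq : p.HolderConjugate q) (a : ℕ → ℝ≥0) {Ω : ℕ → ℝ≥0}
    (hΩ0 : Ω 0 ≠ 0) (N : ℕ) :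
    ∑ i ∈ Finset.range (N + 1), level a Ω N i ^ q * Ω i ≤
      p.toNNReal * ∑ i ∈ Finset.range (N + 1), a i * level a Ω N i ^ (q - 1) := by
  have hq := hpq.symm.lt
  have hN : level a Ω N (N + 1) = 0 := by simp [level]
  rw [← NNReal.coe_le_coe]
  push_cast
  simp_rw [mul_comm ((a _ : ℝ≥0) : ℝ)]
  rw [sum_mul_eq_sum_partial_mul_sub (fun i => (level a Ω N i : ℝ) ^ q) (fun i => (Ω i : ℝ)),
    sum_mul_eq_sum_partial_mul_sub (fun i => (level a Ω N i : ℝ) ^ (q - 1)) (fun i => (a i : ℝ)),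
    hN, NNReal.coe_zero, Real.zero_rpow (by linarith), Real.zero_rpow (by linarith), mul_zero,
    mul_zero, add_zero, add_zero, Finset.mul_sum, Real.coe_toNNReal _ hpq.nonneg]
  refine Finset.sum_le_sum fun n hn => ?_
  have hW := sum_range_pos hΩ0 n
  -- where the level function drops, it equals the quotient of the partial sums
  have hmax : level a Ω N n = max ((∑ j ∈ Finset.range (n + 1), a j) /
      ∑ j ∈ Finset.range (n + 1), Ω j) (level a Ω N (n + 1)) := by
    rw [level, ← Finset.insert_Icc_add_one_left_eq_Icc
      (Nat.lt_succ_iff.1 (Finset.mem_range.1 hn)), Finset.sup_insert]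
    rfl
  rcases max_choice ((∑ j ∈ Finset.range (n + 1), a j) /
      ∑ j ∈ Finset.range (n + 1), Ω j) (level a Ω N (n + 1)) with h | h
  · have h1 : (∑ j ∈ Finset.range (n + 1), (Ω j : ℝ)) * level a Ω N n =
        ∑ j ∈ Finset.range (n + 1), (a j : ℝ) := by
      rw [h] at hmax
      rw [hmax]
      exact_mod_cast mul_div_cancel₀ _ hW.ne'
    calc (∑ j ∈ Finset.range (n + 1), (Ω j : ℝ)) *
          ((level a Ω N n : ℝ) ^ q - (level a Ω N (n + 1) : ℝ) ^ q)
        ≤ (∑ j ∈ Finset.range (n + 1), (Ω j : ℝ)) * (p * (level a Ω N n *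
            ((level a Ω N n : ℝ) ^ (q - 1) - (level a Ω N (n + 1) : ℝ) ^ (q - 1)))) := by
          gcongr
          exact rpow_sub_rpow_le hpq NNReal.zero_le_coe NNReal.zero_le_coe
      _ = p * (((∑ j ∈ Finset.range (n + 1), (Ω j : ℝ)) * level a Ω N n) *
            ((level a Ω N n : ℝ) ^ (q - 1) - (level a Ω N (n + 1) : ℝ) ^ (q - 1))) := by ring
      _ = _ := by rw [h1]
  · rw [hmax, h]; simp

theorem rpow_mul_hardy_rpow_le {q : ℝ} (hq : 1 < q) {a Ω : ℕ → ℝ≥0} (ha : Antitone a)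
    {n N : ℕ} (hn : n ≤ N) :
    a n ^ q * hardy Ω n ^ (1 - q) ≤ a n * level a Ω N n ^ (q - 1) := by
  have h1 : a n ^ q = a n * a n ^ (q - 1) := by
    rw [← NNReal.rpow_one_add' (by linarith)]
    congr 1; ring
  rw [h1, ← neg_sub q 1, NNReal.rpow_neg, mul_assoc, ← div_eq_mul_inv, ← NNReal.div_rpow]
  have hq0 : 0 ≤ q - 1 := by linarith
  gcongr
  refine le_trans ?_ (Finset.le_sup (f := fun k => (∑ j ∈ Finset.range (k + 1), a j) /
    ∑ j ∈ Finset.range (k + 1), Ω j) (Finset.mem_Icc.2 ⟨le_rfl, hn⟩))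
  rw [hardy, div_div_eq_mul_div]
  gcongr
  have := Finset.card_nsmul_le_sum (Finset.range (n + 1)) a (a n) fun i hi =>
    ha (Nat.lt_succ_iff.1 (Finset.mem_range.1 hi))
  rw [Finset.card_range, nsmul_eq_mul] at this
  rw [mul_comm]
  exact_mod_cast this

/-- The lower bound for the associate norm, tested on the power `q - 1` of the level function. -/
theorem sum_rearrangement_rpow_mul_hardy_le {p q : ℝ} (hpq : p.HolderConjugate q)
    {Ω : ℕ → ℝ≥0} (hΩ0 : Ω 0 ≠ 0) (f : ℕ → ℂ) (N : ℕ) :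
    ∑ n ∈ Finset.range (N + 1), rearrangement f n ^ q * (hardy Ω n : ℝ≥0∞) ^ (1 - q) ≤
      (p.toNNReal : ℝ≥0∞) ^ (q - 1) *
        associateNorm (lorentzNorm (fun k => (Ω k : ℝ≥0∞)) p) f ^ q := by
  have hp := hpq.pos
  have hq := hpq.symm.pos
  have hq1 := hpq.symm.lt
  have hP : p.toNNReal ≠ 0 := by simpa using hp
  rcases eq_or_ne (associateNorm (lorentzNorm (fun k => (Ω k : ℝ≥0∞)) p) f) ∞ with htop | htop
  · rw [htop, ENNReal.top_rpow_of_pos hq, ENNReal.mul_top]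
    · exact le_top
    · simp [ENNReal.rpow_eq_zero_iff, hp]
  set A := associateNorm (lorentzNorm (fun k => (Ω k : ℝ≥0∞)) p) f with hA
  have hfin := rearrangement_ne_top_of_associateNorm_ne_top hp hΩ0 htop
  set a : ℕ → ℝ≥0 := fun n => (rearrangement f n).toNNReal with ha
  have hfa : ∀ n, rearrangement f n = a n := fun n => (ENNReal.coe_toNNReal (hfin n)).symm
  have hanti : Antitone a := fun m n hmn =>
    ENNReal.toNNReal_mono (hfin m) (rearrangement_antitone f hmn)
  set S : ℝ≥0 := ∑ i ∈ Finset.range (N + 1), a i * level a Ω N i ^ (q - 1) with hS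
  have hTS : ∑ n ∈ Finset.range (N + 1), rearrangement f n ^ q * (hardy Ω n : ℝ≥0∞) ^ (1 - q) ≤
      (S : ℝ≥0∞) := by
    rw [hS, ENNReal.ofNNReal_finsetSum]
    refine Finset.sum_le_sum fun n hn => ?_
    rw [hfa, ← ENNReal.coe_rpow_of_nonneg _ hq.le,
      ← ENNReal.coe_rpow_of_ne_zero (hardy_pos hΩ0 n).ne', ← ENNReal.coe_mul]
    exact_mod_cast rpow_mul_hardy_rpow_le hq1 hanti (Nat.lt_succ_iff.1 (Finset.mem_range.1 hn))
  refine hTS.trans ?_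
  rcases eq_or_ne S 0 with hS0 | hS0
  · rw [hS0]; exact zero_le
  have hPS : p.toNNReal * S ≠ 0 := mul_ne_zero hP hS0
  have hqp : q / p = q - 1 := by
    have := hpq.symm.sub_one_mul_conj
    field_simp
    linarith
  have hSA : ((S * (p.toNNReal * S) ^ (-(1 / p)) : ℝ≥0) : ℝ≥0∞) ≤ A := by
    have h1 := sum_rearrangement_mul_le_associateNorm hp Ω f
      (h := fun i => level a Ω N i ^ (q - 1) * (p.toNNReal * S) ^ (-(1 / p)))
      (fun m n hmn => by
        have hq0 : 0 ≤ q - 1 := by linarith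
        dsimp only
        gcongr
        exact level_antitone a Ω N hmn) (N := N + 1) ?_
    · refine le_trans (le_of_eq ?_) h1
      rw [hS, Finset.sum_mul, ENNReal.ofNNReal_finsetSum]
      refine Finset.sum_congr rfl fun n _ => ?_
      rw [hfa, ← ENNReal.coe_mul, mul_assoc]
    · have h2 : ∀ i, (level a Ω N i ^ (q - 1) * (p.toNNReal * S) ^ (-(1 / p))) ^ p =
          level a Ω N i ^ q * (p.toNNReal * S)⁻¹ := by
        intro i
        rw [NNReal.mul_rpow, ← NNReal.rpow_mul, ← NNReal.rpow_mul, hpq.symm.sub_one_mul_conj,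
          neg_mul, one_div_mul_cancel hp.ne', NNReal.rpow_neg_one]
      have h3 : ∑ i ∈ Finset.range (N + 1),
          (level a Ω N i ^ (q - 1) * (p.toNNReal * S) ^ (-(1 / p))) ^ p * Ω i ≤ 1 := by
        simp_rw [h2, mul_right_comm]
        rw [← Finset.sum_mul, ← div_eq_mul_inv]
        exact div_le_one_of_le₀ (sum_level_rpow_le hpq a hΩ0 N) (zero_le)
      simp_rw [← ENNReal.coe_rpow_of_nonneg _ hp.le, ← ENNReal.coe_mul]
      exact_mod_cast h3
  have hSeq : S = p.toNNReal ^ (q - 1) * (S * (p.toNNReal * S) ^ (-(1 / p))) ^ q := by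
    rw [NNReal.mul_rpow, ← NNReal.rpow_mul, NNReal.mul_rpow,
      show -(1 / p) * q = -(q - 1) by rw [← hqp]; ring, mul_left_comm (S ^ q), ← mul_assoc,
      ← NNReal.rpow_add hP, add_neg_cancel, NNReal.rpow_zero, one_mul, ← NNReal.rpow_add hS0]
    simp
  calc (S : ℝ≥0∞)
      = (p.toNNReal : ℝ≥0∞) ^ (q - 1) *
          ((S * (p.toNNReal * S) ^ (-(1 / p)) : ℝ≥0) : ℝ≥0∞) ^ q := by
        rw [← ENNReal.coe_rpow_of_nonneg _ hq.le, ← ENNReal.coe_rpow_of_nonneg _ (by linarith),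
          ← ENNReal.coe_mul, ← hSeq]
    _ ≤ _ := by gcongr

/-- If the partial sums of `Ω^{1-q}` are controlled by those of `(A_d Ω)^{1-q}`, then the converse
of Hölder's inequality holds up to a constant. -/
theorem lorentzNorm_le_associateNorm {p q : ℝ} (hpq : p.HolderConjugate q)
    {Ω : ℕ → ℝ≥0} (hΩ0 : Ω 0 ≠ 0) {C : ℝ≥0}
    (hC : ∀ n : ℕ, ∑ k ∈ Finset.range (n + 1), (Ω k : ℝ≥0∞) ^ (1 - q) ≤
      C * ∑ k ∈ Finset.range (n + 1), (hardy Ω k : ℝ≥0∞) ^ (1 - q)) (f : ℕ → ℂ) :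
    lorentzNorm (weightPow Ω (1 - q)) q f ≤ ((C * p.toNNReal ^ (q - 1)) ^ (1 / q) : ℝ≥0) *
      associateNorm (lorentzNorm (fun k => (Ω k : ℝ≥0∞)) p) f := by
  have hq := hpq.symm.pos
  have hq1 := hpq.symm.lt
  set A := associateNorm (lorentzNorm (fun k => (Ω k : ℝ≥0∞)) p) f with hA
  have hsum : ∑' n, rearrangement f n ^ q * weightPow Ω (1 - q) n ≤
      ((C * p.toNNReal ^ (q - 1) : ℝ≥0) : ℝ≥0∞) * A ^ q := by
    rw [ENNReal.tsum_eq_iSup_nat]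
    refine iSup_le fun N => ?_
    calc ∑ n ∈ Finset.range N, rearrangement f n ^ q * weightPow Ω (1 - q) n
        ≤ ∑ n ∈ Finset.range N, rearrangement f n ^ q * (C * (hardy Ω n : ℝ≥0∞) ^ (1 - q)) := by
          refine sum_mul_le_sum_mul_of_antitone (fun m _ => ?_)
            fun i j hij => ENNReal.rpow_le_rpow (rearrangement_antitone f hij) hq.le
          rw [← Finset.mul_sum]
          rcases m with _ | m
          · simp
          · exact hC m
      _ ≤ ∑ n ∈ Finset.range (N + 1),
            rearrangement f n ^ q * (C * (hardy Ω n : ℝ≥0∞) ^ (1 - q)) := by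
          gcongr
          exact N.le_succ
      _ = C * ∑ n ∈ Finset.range (N + 1),
            rearrangement f n ^ q * (hardy Ω n : ℝ≥0∞) ^ (1 - q) := by
          rw [Finset.mul_sum]
          exact Finset.sum_congr rfl fun _ _ => mul_left_comm _ _ _
      _ ≤ C * ((p.toNNReal : ℝ≥0∞) ^ (q - 1) * A ^ q) := by
          gcongr
          exact sum_rearrangement_rpow_mul_hardy_le hpq hΩ0 f N
      _ = _ := by
          rw [← mul_assoc, ENNReal.coe_mul, ENNReal.coe_rpow_of_nonneg _ (by linarith)]
  calc lorentzNorm (weightPow Ω (1 - q)) q f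
      ≤ (((C * p.toNNReal ^ (q - 1) : ℝ≥0) : ℝ≥0∞) * A ^ q) ^ (1 / q) := by
        unfold lorentzNorm
        gcongr
    _ = _ := by
        rw [ENNReal.mul_rpow_of_nonneg _ _ (by positivity), ← ENNReal.rpow_mul,
          mul_one_div_cancel hq.ne', ENNReal.rpow_one, ENNReal.coe_rpow_of_nonneg _ (by positivity)]

/-! ### The associate norm of the indicator of an initial segment -/

theorem sum_Ico_tsub_of_antitone {w : ℕ → ℝ≥0} (hw : Antitone w) {m M : ℕ} (hmM : m ≤ M) :
    ∑ k ∈ Finset.Ico m M, (w k - w (k + 1)) = w m - w M := by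
  induction M, hmM using Nat.le_induction with
  | base => simp
  | succ M hM ih =>
    rw [Finset.sum_Ico_succ_top hM, ih, tsub_add_tsub_cancel (hw hM) (hw M.le_succ)]

theorem add_one_rpow_le_mul_sum {p q : ℝ} (hpq : p.HolderConjugate q) (k : ℕ) :
    ((k : ℝ≥0) + 1) ^ q ≤ q.toNNReal * ∑ j ∈ Finset.range (k + 1), ((j : ℝ≥0) + 1) ^ (q - 1) := by
  have hq := hpq.symm.pos
  have hqp : q / p = q - 1 := by
    have := hpq.symm.sub_one_mul_conj
    have := hpq.pos
    field_simp
    linarith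
  have key : ∀ k : ℕ, ((k : ℝ) + 1) ^ q ≤ (k : ℝ) ^ q + q * ((k : ℝ) + 1) ^ (q - 1) := by
    intro k
    have hy := mul_rpow_sub_one_le hpq (c := (k : ℝ)) (d := (k : ℝ) + 1) (by positivity)
      (by positivity)
    have h1 := mul_rpow_sub_one hq.ne' (c := (k : ℝ) + 1) (by positivity)
    have h2 : q * ((k : ℝ) * ((k : ℝ) + 1) ^ (q - 1)) ≤
        (k : ℝ) ^ q + (q - 1) * ((k : ℝ) + 1) ^ q := by
      calc q * ((k : ℝ) * ((k : ℝ) + 1) ^ (q - 1))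
          ≤ q * ((k : ℝ) ^ q / q + ((k : ℝ) + 1) ^ q / p) := by gcongr
        _ = (k : ℝ) ^ q + q / p * ((k : ℝ) + 1) ^ q := by field_simp
        _ = _ := by rw [hqp]
    have h3 : q * ((k : ℝ) * ((k : ℝ) + 1) ^ (q - 1)) + q * ((k : ℝ) + 1) ^ (q - 1) =
        q * ((k : ℝ) + 1) ^ q := by rw [← h1]; ring
    linarith
  rw [← NNReal.coe_le_coe]
  push_cast
  rw [Real.coe_toNNReal _ hq.le]
  induction k with
  | zero =>
    have := key 0
    simpa [Real.zero_rpow hq.ne'] using this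
  | succ k ih =>
    rw [Finset.sum_range_succ, mul_add]
    refine (key (k + 1)).trans ?_
    gcongr
    exact_mod_cast ih

/-- A nonincreasing majorant of `(A_d Ω)^{1-q}` on `{0, …, n}` whose sum exceeds that of
`(A_d Ω)^{1-q}` at most by a constant factor, obtained by replacing `(∑_{j ≤ k} Ω j)^{1-q}` by its
decrements. -/
theorem exists_majorant {p q : ℝ} (hpq : p.HolderConjugate q) {Ω : ℕ → ℝ≥0} (hΩ0 : Ω 0 ≠ 0)
    (n : ℕ) : ∃ h : ℕ → ℝ≥0, (∀ i m, i ≤ m → m ≤ n → hardy Ω m ^ (1 - q) ≤ h i) ∧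
      ∑ i ∈ Finset.range (n + 1), h i ≤
        q.toNNReal * ∑ i ∈ Finset.range (n + 1), hardy Ω i ^ (1 - q) := by
  have hq1 := hpq.symm.lt
  have hq0 : 0 ≤ q - 1 := by linarith
  set w : ℕ → ℝ≥0 := fun k =>
    if k ≤ n then (∑ j ∈ Finset.range (k + 1), Ω j) ^ (1 - q) else 0 with hw
  have hanti : Antitone w := by
    intro i j hij
    by_cases hj : j ≤ n
    · simp only [hw, if_pos hj, if_pos (hij.trans hj)]
      refine NNReal.rpow_le_rpow_of_nonpos (sum_range_pos hΩ0 i) ?_ (by linarith)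
      exact Finset.sum_le_sum_of_subset (Finset.range_mono (by lia))
    · simp [hw, if_neg hj]
  have htele : ∀ m ≤ n, ∑ k ∈ Finset.Ico m (n + 1), (w k - w (k + 1)) = w m := by
    intro m hm
    rw [sum_Ico_tsub_of_antitone hanti (by lia)]
    simp [hw]
  have hhardy : ∀ m ≤ n, ((m : ℝ≥0) + 1) ^ (q - 1) * w m = hardy Ω m ^ (1 - q) := by
    intro m hm
    rw [hardy, NNReal.div_rpow, ← neg_sub q 1, NNReal.rpow_neg (_ + 1), div_inv_eq_mul, mul_comm]
    simp [hw, hm]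
  refine ⟨fun i => ∑ k ∈ Finset.Ico i (n + 1), ((k : ℝ≥0) + 1) ^ (q - 1) * (w k - w (k + 1)),
    fun i m him hmn => ?_, ?_⟩
  · rw [← hhardy m hmn, ← htele m hmn, Finset.mul_sum]
    calc ∑ k ∈ Finset.Ico m (n + 1), ((m : ℝ≥0) + 1) ^ (q - 1) * (w k - w (k + 1))
        ≤ ∑ k ∈ Finset.Ico m (n + 1), ((k : ℝ≥0) + 1) ^ (q - 1) * (w k - w (k + 1)) := by
          gcongr with k hk
          exact (Finset.mem_Ico.1 hk).1
      _ ≤ _ := Finset.sum_le_sum_of_subset (Finset.Ico_subset_Ico_left him)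
  · simp_rw [Finset.range_eq_Ico]
    rw [Finset.sum_Ico_Ico_comm]
    calc ∑ k ∈ Finset.Ico 0 (n + 1), ∑ i ∈ Finset.Ico 0 (k + 1),
          ((k : ℝ≥0) + 1) ^ (q - 1) * (w k - w (k + 1))
        = ∑ k ∈ Finset.Ico 0 (n + 1), ((k : ℝ≥0) + 1) ^ q * (w k - w (k + 1)) := by
          refine Finset.sum_congr rfl fun k _ => ?_
          rw [Finset.sum_const, Nat.card_Ico, nsmul_eq_mul, ← mul_assoc]
          congr 1
          push_cast
          rw [← NNReal.rpow_one_add' (by linarith), add_sub_cancel]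
      _ ≤ ∑ k ∈ Finset.Ico 0 (n + 1), (q.toNNReal *
            ∑ j ∈ Finset.Ico 0 (k + 1), ((j : ℝ≥0) + 1) ^ (q - 1)) * (w k - w (k + 1)) := by
          gcongr with k hk
          simpa only [Finset.range_eq_Ico] using add_one_rpow_le_mul_sum hpq k
      _ = q.toNNReal * ∑ k ∈ Finset.Ico 0 (n + 1), ∑ j ∈ Finset.Ico 0 (k + 1),
            ((j : ℝ≥0) + 1) ^ (q - 1) * (w k - w (k + 1)) := by
          simp_rw [mul_assoc, ← Finset.mul_sum, Finset.sum_mul]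
      _ = q.toNNReal * ∑ j ∈ Finset.Ico 0 (n + 1), hardy Ω j ^ (1 - q) := by
          rw [← Finset.sum_Ico_Ico_comm]
          congr 1
          refine Finset.sum_congr rfl fun j hj => ?_
          have hjn : j ≤ n := Nat.lt_succ_iff.1 (Finset.mem_Ico.1 hj).2
          rw [← Finset.mul_sum, htele j hjn, hhardy j hjn]

/-- Hölder's inequality with the weight `x_i` for which `x_i^p` is a power of the majorant above;
its partial sums are at most those of `Ω`, so that monotonicity of `b` leads back to `Ω`. -/
theorem sum_le_of_antitone {p q : ℝ} (hpq : p.HolderConjugate q) {Ω : ℕ → ℝ≥0} (hΩ0 : Ω 0 ≠ 0)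
    {b : ℕ → ℝ≥0∞} (hb : Antitone b) (n : ℕ) :
    ∑ i ∈ Finset.range (n + 1), b i ≤ (∑ i ∈ Finset.range (n + 1), b i ^ p * Ω i) ^ (1 / p) *
      ((q.toNNReal * ∑ i ∈ Finset.range (n + 1), hardy Ω i ^ (1 - q) : ℝ≥0) : ℝ≥0∞) ^ (1 / q) := by
  have hp := hpq.pos
  have hq := hpq.symm.pos
  obtain ⟨h, hh, hsum⟩ := exists_majorant hpq hΩ0 n
  have hpos : ∀ i ≤ n, h i ≠ 0 := fun i hi =>
    ((NNReal.rpow_pos (hardy_pos hΩ0 n)).trans_le (hh i n hi le_rfl)).ne'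
  have hpq1 : (q - 1) * (p - 1) = 1 := by
    have := hpq.sub_one_mul_conj
    linarith
  have hx : ∀ i ≤ n, ((h i ^ (-(1 / q)) : ℝ≥0) : ℝ≥0∞) * ((h i ^ (1 / q) : ℝ≥0) : ℝ≥0∞) = 1 := by
    intro i hi
    rw [← ENNReal.coe_mul, ← NNReal.rpow_add (hpos i hi), neg_add_cancel, NNReal.rpow_zero,
      ENNReal.coe_one]
  calc ∑ i ∈ Finset.range (n + 1), b i
      = ∑ i ∈ Finset.range (n + 1),
          (b i * (h i ^ (-(1 / q)) : ℝ≥0)) * ((h i ^ (1 / q) : ℝ≥0) : ℝ≥0∞) := by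
        refine Finset.sum_congr rfl fun i hi => ?_
        rw [mul_assoc, hx i (Nat.lt_succ_iff.1 (Finset.mem_range.1 hi)), mul_one]
    _ ≤ (∑ i ∈ Finset.range (n + 1), (b i * (h i ^ (-(1 / q)) : ℝ≥0)) ^ p) ^ (1 / p) *
          (∑ i ∈ Finset.range (n + 1), ((h i ^ (1 / q) : ℝ≥0) : ℝ≥0∞) ^ q) ^ (1 / q) :=
        ENNReal.inner_le_Lp_mul_Lq _ _ _ hpq
    _ ≤ _ := by
        gcongr ?_ ^ (1 / p) * ?_ ^ (1 / q)
        · have h1 : ∀ i, (b i * (h i ^ (-(1 / q)) : ℝ≥0)) ^ p =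
              b i ^ p * ((h i ^ (-(p - 1)) : ℝ≥0) : ℝ≥0∞) := by
            intro i
            rw [ENNReal.mul_rpow_of_nonneg _ _ hp.le, ← ENNReal.coe_rpow_of_nonneg _ hp.le,
              ← NNReal.rpow_mul]
            congr 4
            have := hpq.sub_one_mul_conj
            field_simp
            linarith
          simp_rw [h1]
          refine sum_mul_le_sum_mul_of_antitone (fun m hm => ?_)
            fun i j hij => ENNReal.rpow_le_rpow (hb hij) hp.le
          rcases m with _ | m
          · simp
          have h2 : ∀ i ∈ Finset.range (m + 1), h i ^ (-(p - 1)) ≤ hardy Ω m := by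
            intro i hi
            have h3 := NNReal.rpow_le_rpow_of_nonpos (z := -(p - 1))
              (NNReal.rpow_pos (hardy_pos hΩ0 m))
              (hh i m (Nat.lt_succ_iff.1 (Finset.mem_range.1 hi)) (by lia))
              (by linarith [hpq.lt])
            rw [← NNReal.rpow_mul, show (1 - q) * -(p - 1) = 1 by linarith,
              NNReal.rpow_one] at h3
            exact h3
          have h4 := Finset.sum_le_card_nsmul _ _ _ h2
          rw [Finset.card_range, nsmul_eq_mul, hardy] at h4
          push_cast at h4
          rw [mul_div_cancel₀ _ (by positivity)] at h4
          exact_mod_cast h4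
        · refine le_trans (le_of_eq ?_) (ENNReal.coe_le_coe.2 hsum)
          rw [ENNReal.ofNNReal_finsetSum]
          refine Finset.sum_congr rfl fun i _ => ?_
          rw [← ENNReal.coe_rpow_of_nonneg _ hq.le, ← NNReal.rpow_mul,
            one_div_mul_cancel hq.ne', NNReal.rpow_one]

theorem sum_range_enorm_le {p q : ℝ} (hpq : p.HolderConjugate q) {Ω : ℕ → ℝ≥0} (hΩ0 : Ω 0 ≠ 0)
    {g : ℕ → ℂ} (hg : lorentzNorm (fun k => (Ω k : ℝ≥0∞)) p g ≤ 1) (n : ℕ) :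
    ∑ k ∈ Finset.range (n + 1), ‖g k‖ₑ ≤
      (((q.toNNReal * ∑ i ∈ Finset.range (n + 1), hardy Ω i ^ (1 - q)) ^ (1 / q) : ℝ≥0) : ℝ≥0∞) := by
  have hp := hpq.pos
  have hq := hpq.symm.pos
  have h1 := sum_enorm_le_sum_rearrangement g (Finset.range (n + 1))
  rw [Finset.card_range] at h1
  refine h1.trans ((sum_le_of_antitone hpq hΩ0 (rearrangement_antitone g) n).trans ?_)
  rw [ENNReal.coe_rpow_of_nonneg _ (by positivity)]
  refine mul_le_of_le_one_left' (le_trans ?_ hg)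
  unfold lorentzNorm
  gcongr
  exact ENNReal.sum_le_tsum _

/-! ### Necessity of the condition -/

/-- If the condition fails, multiples of indicators of initial segments `{0, …, n j}` on which the
two functionals compare worse and worse add up to a nonincreasing sequence in the associate space
that has infinite Lorentz norm. -/
theorem exists_bound_of_subset {p q : ℝ} (hpq : p.HolderConjugate q) {Ω : ℕ → ℝ≥0}
    (hΩ0 : Ω 0 ≠ 0)
    (hsub : associateSpace (lorentzNorm (fun k => (Ω k : ℝ≥0∞)) p) ⊆
      lorentzSpace (weightPow Ω (1 - q)) q) :
    ∃ C : ℝ≥0, ∀ n : ℕ, ∑ k ∈ Finset.range (n + 1), (Ω k : ℝ≥0∞) ^ (1 - q) ≤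
      C * ∑ k ∈ Finset.range (n + 1), (hardy Ω k : ℝ≥0∞) ^ (1 - q) := by
  have hq := hpq.symm.pos
  set V : ℕ → ℝ≥0 := fun n => ∑ k ∈ Finset.range (n + 1), hardy Ω k ^ (1 - q) with hV
  have hVcoe : ∀ n, ∑ k ∈ Finset.range (n + 1), (hardy Ω k : ℝ≥0∞) ^ (1 - q) = V n := by
    intro n
    rw [hV, ENNReal.ofNNReal_finsetSum]
    exact Finset.sum_congr rfl fun k _ => (ENNReal.coe_rpow_of_ne_zero (hardy_pos hΩ0 k).ne' _).symm
  simp_rw [hVcoe]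
  have hV0 : V 0 ≠ 0 := by
    simp only [hV, zero_add, Finset.sum_range_one]
    exact (NNReal.rpow_pos (hardy_pos hΩ0 0)).ne'
  have hVle : ∀ n, V 0 ≤ V n := fun n =>
    Finset.sum_le_sum_of_subset (Finset.range_mono (by lia))
  have hVn : ∀ n, V n ≠ 0 := fun n => ((pos_iff_ne_zero.2 hV0).trans_le (hVle n)).ne'
  by_contra! hcon
  -- the failure at `4 ^ j` outweighs the coefficients `2 ^ (-j)` that make the series converge
  choose n hn using fun j : ℕ => hcon ((4 ^ j) ^ q)
  obtain ⟨c, hc⟩ : ∃ c : ℕ → ℝ≥0, ∀ j, c j = (1 / 2) ^ j * V (n j) ^ (-(1 / q)) :=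
    ⟨_, fun _ => rfl⟩
  obtain ⟨φ, hφ⟩ : ∃ φ : ℕ → ℕ → ℝ≥0, ∀ k j, φ k j = if k ≤ n j then c j else 0 :=
    ⟨_, fun _ _ => rfl⟩
  have hsumm : ∀ k, Summable (φ k) := by
    intro k
    refine NNReal.summable_of_le (f := fun j => (1 / 2) ^ j * V 0 ^ (-(1 / q))) (fun j => ?_)
      ((NNReal.summable_geometric (by
        rw [← NNReal.coe_lt_coe]; norm_num)).mul_right _)
    refine (show φ k j ≤ c j by rw [hφ]; split_ifs <;> simp).trans ?_
    rw [hc]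
    refine mul_le_mul' le_rfl (NNReal.rpow_le_rpow_of_nonpos (pos_iff_ne_zero.2 hV0) (hVle _) ?_)
    simpa using hq.le
  obtain ⟨f, hf⟩ : ∃ f : ℕ → ℝ≥0, ∀ k, f k = ∑' j, φ k j := ⟨_, fun _ => rfl⟩
  have hfanti : Antitone f := by
    intro i k hik
    rw [hf, hf]
    refine (hsumm k).tsum_le_tsum (fun j => ?_) (hsumm i)
    by_cases hk : k ≤ n j
    · simp [hφ, hk, hik.trans hk]
    · simp [hφ, hk]
  have hmem : (fun k => ((f k : ℝ) : ℂ)) ∈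
      associateSpace (lorentzNorm (fun k => (Ω k : ℝ≥0∞)) p) := by
    have hbound : associateNorm (lorentzNorm (fun k => (Ω k : ℝ≥0∞)) p)
        (fun k => ((f k : ℝ) : ℂ)) ≤ ∑' j : ℕ, (((1 / 2) ^ j * q.toNNReal ^ (1 / q) : ℝ≥0) : ℝ≥0∞) := by
      refine iSup₂_le fun g hg => ?_
      have h1 : ∀ k, ‖((f k : ℝ) : ℂ) * g k‖ₑ = ∑' j, (φ k j : ℝ≥0∞) * ‖g k‖ₑ := by
        intro k
        have h2 : ‖((f k : ℝ) : ℂ)‖ₑ = (f k : ℝ≥0∞) := by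
          rw [enorm_eq_nnnorm]; congr 1; ext; simp
        rw [enorm_mul, h2, hf, ENNReal.coe_tsum (hsumm k), ENNReal.tsum_mul_right]
      simp_rw [h1]
      rw [ENNReal.tsum_comm]
      refine ENNReal.tsum_le_tsum fun j => ?_
      rw [tsum_eq_sum (s := Finset.range (n j + 1))]
      · calc ∑ k ∈ Finset.range (n j + 1), (φ k j : ℝ≥0∞) * ‖g k‖ₑ
            = c j * ∑ k ∈ Finset.range (n j + 1), ‖g k‖ₑ := by
              rw [Finset.mul_sum]
              refine Finset.sum_congr rfl fun k hk => ?_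
              simp only [hφ, if_pos (Nat.lt_succ_iff.1 (Finset.mem_range.1 hk))]
          _ ≤ c j * (((q.toNNReal * V (n j)) ^ (1 / q) : ℝ≥0) : ℝ≥0∞) := by
              gcongr
              exact sum_range_enorm_le hpq hΩ0 hg (n j)
          _ = _ := by
              rw [← ENNReal.coe_mul, hc, NNReal.mul_rpow, mul_assoc, mul_left_comm (V (n j) ^ _),
                ← NNReal.rpow_add (hVn _), neg_add_cancel, NNReal.rpow_zero, mul_one]
      · intro k hk
        have : ¬ k ≤ n j := by simpa [Nat.lt_succ_iff] using hk
        simp [hφ, this]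
    refine hbound.trans_lt ?_
    rw [← ENNReal.coe_tsum ((NNReal.summable_geometric (by
        rw [← NNReal.coe_lt_coe]; norm_num)).mul_right _)]
    exact ENNReal.coe_lt_top
  have hlt : lorentzNorm (weightPow Ω (1 - q)) q (fun k => ((f k : ℝ) : ℂ)) < ∞ := hsub hmem
  have hlarge : ∀ j : ℕ, (2 ^ j : ℝ≥0∞) ≤
      lorentzNorm (weightPow Ω (1 - q)) q (fun k => ((f k : ℝ) : ℂ)) := by
    intro j
    have hcq : c j ^ q * ((4 ^ j) ^ q * V (n j)) = (2 ^ j) ^ q := by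
      rw [hc, NNReal.mul_rpow, ← NNReal.rpow_mul, neg_mul, one_div_mul_cancel hq.ne',
        NNReal.rpow_neg_one, mul_mul_mul_comm, inv_mul_cancel₀ (hVn _), mul_one,
        ← NNReal.mul_rpow, ← mul_pow]
      congr 2
      ext; norm_num
    have h1 : ((2 ^ j : ℝ≥0∞)) ^ q ≤
        ∑' k, rearrangement (fun k => ((f k : ℝ) : ℂ)) k ^ q * weightPow Ω (1 - q) k := by
      calc ((2 ^ j : ℝ≥0∞)) ^ q = ((c j ^ q * ((4 ^ j) ^ q * V (n j)) : ℝ≥0) : ℝ≥0∞) := by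
            rw [hcq, ENNReal.coe_rpow_of_nonneg _ hq.le]
            norm_num
        _ = (c j : ℝ≥0∞) ^ q * (((4 ^ j) ^ q : ℝ≥0) * V (n j)) := by
            rw [ENNReal.coe_mul, ENNReal.coe_mul, ENNReal.coe_rpow_of_nonneg (c j) hq.le]
        _ ≤ (c j : ℝ≥0∞) ^ q * ∑ k ∈ Finset.range (n j + 1), (Ω k : ℝ≥0∞) ^ (1 - q) := by
            exact mul_le_mul' le_rfl (hn j).le
        _ = ∑ k ∈ Finset.range (n j + 1), (c j : ℝ≥0∞) ^ q * weightPow Ω (1 - q) k := by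
            rw [Finset.mul_sum]; rfl
        _ ≤ ∑ k ∈ Finset.range (n j + 1),
              rearrangement (fun k => ((f k : ℝ) : ℂ)) k ^ q * weightPow Ω (1 - q) k := by
            refine Finset.sum_le_sum fun k hk => ?_
            gcongr
            refine le_trans ?_ (le_rearrangement_of_antitone hfanti k)
            rw [hf]
            refine ENNReal.coe_le_coe.2 (le_trans ?_ ((hsumm k).le_tsum j fun _ _ => zero_le))
            simp [hφ, Nat.lt_succ_iff.1 (Finset.mem_range.1 hk)]
        _ ≤ _ := ENNReal.sum_le_tsum _
    calc (2 ^ j : ℝ≥0∞) = ((2 ^ j : ℝ≥0∞) ^ q) ^ (1 / q) := by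
          rw [← ENNReal.rpow_mul, mul_one_div_cancel hq.ne', ENNReal.rpow_one]
      _ ≤ _ := by
          unfold lorentzNorm
          gcongr
  obtain ⟨j, hj⟩ := ENNReal.exists_nat_gt hlt.ne
  refine absurd (hj.trans_le ?_) (not_lt.2 (hlarge j))
  exact_mod_cast Nat.lt_two_pow_self.le

/-! ### The equality of the two spaces -/

theorem sum_rpow_le_of_isRegular {q : ℝ} (hq : 1 < q) {Ω : ℕ → ℝ≥0} (hΩ0 : Ω 0 ≠ 0)
    (hreg : IsRegular Ω) :
    ∃ C : ℝ≥0, ∀ n : ℕ, ∑ k ∈ Finset.range (n + 1), (Ω k : ℝ≥0∞) ^ (1 - q) ≤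
      C * ∑ k ∈ Finset.range (n + 1), (hardy Ω k : ℝ≥0∞) ^ (1 - q) := by
  obtain ⟨C, hC⟩ := hreg
  refine ⟨C ^ (q - 1), fun n => ?_⟩
  rw [Finset.mul_sum]
  refine Finset.sum_le_sum fun k _ => ?_
  have hpos : 0 < C * Ω k := (hardy_pos hΩ0 k).trans_le (hC k)
  have hC0 : C ≠ 0 := left_ne_zero_of_mul hpos.ne'
  rw [← ENNReal.coe_rpow_of_ne_zero (right_ne_zero_of_mul hpos.ne'),
    ← ENNReal.coe_rpow_of_ne_zero (hardy_pos hΩ0 k).ne', ← ENNReal.coe_mul]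
  refine ENNReal.coe_le_coe.2 ?_
  calc Ω k ^ (1 - q) = C ^ (q - 1) * (C * Ω k) ^ (1 - q) := by
        rw [NNReal.mul_rpow, ← mul_assoc, ← NNReal.rpow_add hC0]
        simp
    _ ≤ C ^ (q - 1) * hardy Ω k ^ (1 - q) := by
        refine mul_le_mul' le_rfl ?_
        exact NNReal.rpow_le_rpow_of_nonpos (hardy_pos hΩ0 k) (hC k) (by linarith)

theorem associateSpace_eq_lorentzSpace {p q : ℝ} (hpq : p.HolderConjugate q)
    {Ω : ℕ → ℝ≥0} (hΩ0 : Ω 0 ≠ 0)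
    (hC : ∃ C : ℝ≥0, ∀ n : ℕ, ∑ k ∈ Finset.range (n + 1), (Ω k : ℝ≥0∞) ^ (1 - q) ≤
      C * ∑ k ∈ Finset.range (n + 1), (hardy Ω k : ℝ≥0∞) ^ (1 - q)) :
    associateSpace (lorentzNorm (fun k => (Ω k : ℝ≥0∞)) p) =
      lorentzSpace (weightPow Ω (1 - q)) q := by
  obtain ⟨C, hC⟩ := hC
  ext f
  exact ⟨fun hf => (lorentzNorm_le_associateNorm hpq hΩ0 hC f).trans_lt
      (ENNReal.mul_lt_top ENNReal.coe_lt_top hf),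
    fun hf => (associateNorm_le_lorentzNorm hpq Ω f).trans_lt hf⟩

end LorentzSeq

theorem theorem2p4p16 (p p' : ℝ) (hp : 1 < p) (hpp' : p.HolderConjugate p')
    (Ω : ℕ → ℝ≥0) (hΩ0 : Ω 0 ≠ 0) (hΩ : ¬ Summable Ω) :
    (LorentzSeq.associateSpace (LorentzSeq.lorentzNorm (fun k => (Ω k : ℝ≥0∞)) p) =
        LorentzSeq.lorentzSpace (LorentzSeq.weightPow Ω (1 - p')) p' ↔
      ∃ C : ℝ≥0, ∀ n : ℕ,
        ∑ k ∈ Finset.range (n + 1), (Ω k : ℝ≥0∞) ^ (1 - p') ≤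
          C * ∑ k ∈ Finset.range (n + 1), (LorentzSeq.hardy Ω k : ℝ≥0∞) ^ (1 - p')) ∧
    (LorentzSeq.associateSpace (LorentzSeq.lorentzNorm (fun k => (Ω k : ℝ≥0∞)) p) =
        LorentzSeq.lorentzSpace (LorentzSeq.weightPow Ω (1 - p')) p' →
      ∃ C : ℝ≥0, 0 < C ∧ ∀ f : ℕ → ℂ,
        LorentzSeq.associateNorm (LorentzSeq.lorentzNorm (fun k => (Ω k : ℝ≥0∞)) p) f ≤
          C * LorentzSeq.lorentzNorm (LorentzSeq.weightPow Ω (1 - p')) p' f ∧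
        LorentzSeq.lorentzNorm (LorentzSeq.weightPow Ω (1 - p')) p' f ≤
          C * LorentzSeq.associateNorm (LorentzSeq.lorentzNorm (fun k => (Ω k : ℝ≥0∞)) p) f) ∧
    (LorentzSeq.IsRegular Ω →
      LorentzSeq.associateSpace (LorentzSeq.lorentzNorm (fun k => (Ω k : ℝ≥0∞)) p) =
        LorentzSeq.lorentzSpace (LorentzSeq.weightPow Ω (1 - p')) p') := by
  refine ⟨⟨fun h => LorentzSeq.exists_bound_of_subset hpp' hΩ0 h.subset,
    LorentzSeq.associateSpace_eq_lorentzSpace hpp' hΩ0⟩, fun h => ?_, fun hreg =>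
      LorentzSeq.associateSpace_eq_lorentzSpace hpp' hΩ0
        (LorentzSeq.sum_rpow_le_of_isRegular hpp'.symm.lt hΩ0 hreg)⟩
  obtain ⟨C, hC⟩ := LorentzSeq.exists_bound_of_subset hpp' hΩ0 h.subset
  refine ⟨max 1 ((C * p.toNNReal ^ (p' - 1)) ^ (1 / p')), zero_lt_one.trans_le (le_max_left _ _),
    fun f => ⟨?_, ?_⟩⟩
  · refine (LorentzSeq.associateNorm_le_lorentzNorm hpp' Ω f).trans (le_mul_of_one_le_left' ?_)
    exact_mod_cast le_max_left _ _
  · refine (LorentzSeq.lorentzNorm_le_associateNorm hpp' hΩ0 hC f).trans ?_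
    gcongr
    exact le_max_right _ _
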